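/- **Theorem (Generalized ping-pong lemma).** Let $\overline X=(V,E)$ be a (possibly infinite) connected graph with set of vertices $V$ and set of oriented edges $E$; $o(e),t(e)$ denote the origin and the target of $e\in E$, and $\overline e\neq e$ denotes the reversed edge. Let $(\overline X;G_v,A_e)$ be a graph of groups: groups $G_v$ ($v\in V$) and $A_e=A_{\overline e}$ ($e\in E$) with injective homomorphisms $\alpha_e:A_e\to G_{o(e)}$ and $\omega_e=\alpha_{\overline e}:A_e\to G_{t(e)}$. Choose a maximal subtree $T=(V,E_T)\subset\overline X$, let $S=E\setminus E_T$ be the set of oriented edges not in $T$, and let $G=\pi_1(\overline X;G_v,A_e)$ be the fundamental group, i.e. the group generated by the groups $G_v$ ($v\in V$) and the edges $e\in E$, subject to the relations of the groups $G_v$, $\overline e=e^{-1}$ for $e\in E$, $e=1$ for $e\in E_T$, and $e^{-1}\alpha_e(a)e=\omega_e(a)$ for $e\in E$, $a\in A_e$. For $e\in E_T$ let $C(e,T)$ be the set of vertices $v$ such that $e$ belongs to the oriented geodesic path of $T$ from $o(e)$ to $v$. Let $G$ act on a set $\Omega$. Suppose that there are subsets $X_v$ ($v\in V$) and $Z_s$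 ($s\in S$) of $\Omega$, forming the family $\boxminus=\{X_v,Z_s\}$, and subsets $X^e_{o(e)}\subset X_{o(e)}$ ($e\in E_T$; the empty set is allowed except where (IF5) forbids it) which form a *proper interactive family*, that is: 1. (IF1) the sets $X_v,Z_s$ are pairwise disjoint; every $Z_s$ is non-empty; and $X_v\neq\emptyset$ if $G_v\neq\alpha_e(A_e)$ for some $e\in E$ with $o(e)=v$; 2. (IF2) $s(O)\subset Z_s$ for every $s\in S$ and every $O\in\boxminus\setminus\{Z_{\overline s}\}$; 3. (IF3) $\alpha_s(A_s)(Z_s)\subset Z_s$ for $s\in S$; 4. (IF4) $(G_{o(s)}\setminus\alpha_s(A_s))(Z_s)\subset X_{o(s)}$ for $s\in S$; 5. (IF5) $X^e_{o(e)}\neq\emptyset$ for every $e\in E_T$ with $G_{o(e)}\neq\alpha_e(A_e)$; 6. (IF6) $\alpha_e(A_e)(X^e_{o(e)})\subset X^e_{o(e)}$ for $e\in E_T$; 7. (IF7) $(G_{o(e)}\setminus\alpha_e(A_e))(X_v)\subset X^e_{o(e)}$ for $e\in E_T$ and $v\in C(e,T)$; 8. (IF8) $(G_{o(e)}\setminus\alpha_e(A_e))(Z_s)\subset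 X^e_{o(e)}$ for $e\in E_T$ and $s\in S$ with $o(s)\in C(e,T)$; 9. (IF9) for $s\in S$ the restriction of the action of $\alpha_s(A_s)$ to $Z_s$ is faithful, and for $e\in E_T$ with $X^e_{o(e)}\ne\emptyset$ the restriction of the action of $\alpha_e(A_e)$ to $X^e_{o(e)}$ is faithful; 10. (IF10) if $X_v\neq\emptyset$ for some $v\in V$, then there are $w\in V$ and a point of $X_w$ which lies in none of the images $(G_w\setminus\alpha_s(A_s))(Z_s)$ with $s\in S$, $o(s)=w$; $(G_w\setminus\alpha_e(A_e))(X_v)$ with $e\in E_T$, $o(e)=w$, $v\in C(e,T)$; and $(G_w\setminus\alpha_e(A_e))(Z_s)$ with $e\in E_T$, $o(e)=w$, $s\in S$, $o(s)\in C(e,T)$; 11. (IF11) if $S=\{s,\overline s\}$ and $X_v=\emptyset$ for every $v\in V$, then there is a point $p\in\Omega\setminus(Z_s\cup Z_{\overline s})$ with $s(p)\in Z_s$ and $\overline s(p)\in Z_{\overline s}$. Suppose moreover that $S\neq\emptyset$, or that $X^e_{o(e)}$ and $X_v$ are both non-empty for some $e\in E_T$ and some $v\in C(e,T)$. (Given the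 conditions above, this holds automatically unless $G$ coincides with one of its vertex groups.) Then the action of $G$ on $\Omega$ is faithful. -/

import Mathlib

universe u v w x y

/-- A graph in the sense of Serre, possibly infinite, with loops and multiple edges allowed.
`V` is the set of vertices and `ε` the set of geometric (unoriented) edges, each of which is
recorded with its two endpoints listed in some arbitrary order. The set of *oriented* edges is
`ε × Bool`: every geometric edge occurs in it with both of its orientations. -/
structure SerreGraph (V : Type u) (ε : Type v) where
  /-- first endpoint -/
  src : ε → V
  /-- second endpoint -/
  tgt : ε → V

namespace SerreGraph

variable {V : Type u} {ε : Type v}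

/-- The edge `e` with reversed orientation. -/
def bar (e : ε × Bool) : ε × Bool := (e.1, !e.2)

/-- The origin of an oriented edge. -/
def o (Γ : SerreGraph V ε) : ε × Bool → V
  | (e, true) => Γ.src e
  | (e, false) => Γ.tgt e

/-- The target of an oriented edge. -/
def t (Γ : SerreGraph V ε) (e : ε × Bool) : V := Γ.o (bar e)

/-- `Γ.IsPath v w l`: the list `l` of oriented edges is an edge path from `v` to `w`. -/
def IsPath (Γ : SerreGraph V ε) : V → V → List (ε × Bool) → Prop
  | v, w, [] => v = w
  | v, w, e :: l => Γ.o e = v ∧ Γ.IsPath (Γ.t e) w l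

/-- `Γ.IsGeodesicIn T v w l`: `l` is a path from `v` to `w` without backtracking, all of whose
edges belong to `T`. When `T` is a tree, this says that `l` is the geodesic of `T` from `v`
to `w`. -/
def IsGeodesicIn (Γ : SerreGraph V ε) (T : Set (ε × Bool)) (v w : V)
    (l : List (ε × Bool)) : Prop :=
  Γ.IsPath v w l ∧ l.IsChain (fun e f => f ≠ bar e) ∧ ∀ e ∈ l, e ∈ T

/-- `T` is the set of oriented edges of a spanning tree (a maximal subtree) of `Γ`: it is closed
under reversal, it connects any two vertices of `Γ`, and it contains no non-empty closed path
without backtracking. -/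
structure IsSpanningTree (Γ : SerreGraph V ε) (T : Set (ε × Bool)) : Prop where
  bar_mem : ∀ e ∈ T, bar e ∈ T
  connected : ∀ v w : V, ∃ l, Γ.IsPath v w l ∧ ∀ e ∈ l, e ∈ T
  acyclic : ∀ (v : V) (l : List (ε × Bool)), Γ.IsGeodesicIn T v v l → l = []

/-- The set `C(e, T)` of the vertices `v` such that `e` belongs to the oriented geodesic of `T`
from the origin of `e` to `v`. -/
def cone (Γ : SerreGraph V ε) (T : Set (ε × Bool)) (e : ε × Bool) : Set V :=
  {v | ∃ l, Γ.IsGeodesicIn T (Γ.o e) v l ∧ e ∈ l}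

end SerreGraph

/-- A graph of groups on the graph `Γ`: a group for every vertex, a group for every geometric
edge (so that an oriented edge and its reversal have the same edge group), and injective
homomorphisms from every edge group to the groups of the two endpoints. -/
structure GraphOfGroups {V : Type u} {ε : Type v} (Γ : SerreGraph V ε) where
  /-- vertex groups -/
  G : V → Type w
  [groupG : ∀ p, Group (G p)]
  /-- edge groups -/
  A : ε → Type x
  [groupA : ∀ e, Group (A e)]
  srcHom : ∀ e, A e →* G (Γ.src e)
  tgtHom : ∀ e, A e →* G (Γ.tgt e)
  srcHom_injective : ∀ e, Function.Injective (srcHom e)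
  tgtHom_injective : ∀ e, Function.Injective (tgtHom e)

namespace GraphOfGroups

open SerreGraph

variable {V : Type u} {ε : Type v} {Γ : SerreGraph V ε}

attribute [instance] GraphOfGroups.groupG GraphOfGroups.groupA

/-- The boundary injection `α_e : A_e → G_{o(e)}` of an oriented edge. -/
def α (𝒢 : GraphOfGroups.{u, v, w, x} Γ) : (e : ε × Bool) → 𝒢.A e.1 →* 𝒢.G (Γ.o e)
  | (e, true) => 𝒢.srcHom e
  | (e, false) => 𝒢.tgtHom e

/-- The boundary injection `ω_e : A_e → G_{t(e)}` of an oriented edge. -/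
def ω (𝒢 : GraphOfGroups.{u, v, w, x} Γ) (e : ε × Bool) : 𝒢.A e.1 →* 𝒢.G (Γ.t e) :=
  𝒢.α (bar e)

/-- The generators of the fundamental group: all elements of all vertex groups, and all
oriented edges. -/
abbrev Gen (𝒢 : GraphOfGroups.{u, v, w, x} Γ) : Type (max u v w) :=
  (Σ p : V, 𝒢.G p) ⊕ (ε × Bool)

/-- The generator given by an element of a vertex group. -/
def genV (𝒢 : GraphOfGroups.{u, v, w, x} Γ) (p : V) (g : 𝒢.G p) : FreeGroup 𝒢.Gen :=
  FreeGroup.of (Sum.inl ⟨p, g⟩)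

/-- The generator given by an oriented edge. -/
def genE (𝒢 : GraphOfGroups.{u, v, w, x} Γ) (e : ε × Bool) : FreeGroup 𝒢.Gen :=
  FreeGroup.of (Sum.inr e)

/-- The relations of the fundamental group: those of the vertex groups; the reversed edge is the
inverse; the edges of the spanning tree `T` are trivial; and `e⁻¹ α_e(a) e = ω_e(a)`. -/
inductive Rel (𝒢 : GraphOfGroups.{u, v, w, x} Γ) (T : Set (ε × Bool)) : FreeGroup 𝒢.Gen → Prop
  | vertex (p : V) (g h : 𝒢.G p) :
      Rel 𝒢 T (𝒢.genV p g * 𝒢.genV p h * (𝒢.genV p (g * h))⁻¹)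
  | inverse (e : ε × Bool) : Rel 𝒢 T (𝒢.genE (bar e) * 𝒢.genE e)
  | tree (e : ε × Bool) (he : e ∈ T) : Rel 𝒢 T (𝒢.genE e)
  | edge (e : ε × Bool) (a : 𝒢.A e.1) :
      Rel 𝒢 T ((𝒢.genE e)⁻¹ * 𝒢.genV (Γ.o e) (𝒢.α e a) * 𝒢.genE e *
        (𝒢.genV (Γ.t e) (𝒢.ω e a))⁻¹)

/-- The fundamental group `π₁(Γ; G_v, A_e)` of the graph of groups, presented by means of the
spanning tree `T`. -/
abbrev Pi1 (𝒢 : GraphOfGroups.{u, v, w, x} Γ) (T : Set (ε × Bool)) : Type (max u v w) :=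
  PresentedGroup {r | 𝒢.Rel T r}

/-- The canonical homomorphism `G_v → π₁`. -/
def vert (𝒢 : GraphOfGroups.{u, v, w, x} Γ) (T : Set (ε × Bool)) (p : V) :
    𝒢.G p →* 𝒢.Pi1 T :=
  MonoidHom.mk' (fun g => PresentedGroup.mk _ (𝒢.genV p g)) (by
    intro g h
    have key : PresentedGroup.mk {r | 𝒢.Rel T r}
        (𝒢.genV p g * 𝒢.genV p h * (𝒢.genV p (g * h))⁻¹) = 1 :=
      PresentedGroup.one_of_mem (Rel.vertex p g h)
    rw [map_mul, map_mul, map_inv, mul_inv_eq_one] at key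
    exact key.symm)

/-- The element of `π₁` given by an oriented edge. -/
def edge (𝒢 : GraphOfGroups.{u, v, w, x} Γ) (T : Set (ε × Bool)) (e : ε × Bool) : 𝒢.Pi1 T :=
  PresentedGroup.mk _ (𝒢.genE e)

section Interactive

variable (𝒢 : GraphOfGroups.{u, v, w, x} Γ) (T : Set (ε × Bool))
  {Ω : Type y} [MulAction (𝒢.Pi1 T) Ω]

/-- `{X_v, Z_s}` (for `v ∈ V` and `s ∈ S`, where `S` is the complement of `T`), together with the
subsets `X_{o(e)}^e` of `X_{o(e)}` for `e ∈ T`, is an interactive family. The values of `Z`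
outside `S`, and those of `Xe` outside `T`, are irrelevant. The subset `X_{o(e)}^e` has to exist,
as a non-empty subset, only when `α_e(A_e) ≠ G_{o(e)}`; `Xe e = ∅` stands for no subset being
chosen. -/
structure IsInteractive (X : V → Set Ω) (Z Xe : ε × Bool → Set Ω) : Prop where
  if1_XX : ∀ p q, p ≠ q → Disjoint (X p) (X q)
  if1_XZ : ∀ p, ∀ s ∉ T, Disjoint (X p) (Z s)
  if1_ZZ : ∀ s ∉ T, ∀ s' ∉ T, s ≠ s' → Disjoint (Z s) (Z s')
  if1_Z_nonempty : ∀ s ∉ T, (Z s).Nonempty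
  if1_X_nonempty : ∀ e, (𝒢.α e).range ≠ ⊤ → (X (Γ.o e)).Nonempty
  if2_X : ∀ s ∉ T, ∀ p, ∀ z ∈ X p, 𝒢.edge T s • z ∈ Z s
  if2_Z : ∀ s ∉ T, ∀ s' ∉ T, s' ≠ bar s → ∀ z ∈ Z s', 𝒢.edge T s • z ∈ Z s
  if3 : ∀ s ∉ T, ∀ a, ∀ z ∈ Z s, 𝒢.vert T (Γ.o s) (𝒢.α s a) • z ∈ Z s
  if4 : ∀ s ∉ T, ∀ g ∉ (𝒢.α s).range, ∀ z ∈ Z s, 𝒢.vert T (Γ.o s) g • z ∈ X (Γ.o s)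
  if5_subset : ∀ e ∈ T, Xe e ⊆ X (Γ.o e)
  if5_nonempty : ∀ e ∈ T, (𝒢.α e).range ≠ ⊤ → (Xe e).Nonempty
  if6 : ∀ e ∈ T, ∀ a, ∀ z ∈ Xe e, 𝒢.vert T (Γ.o e) (𝒢.α e a) • z ∈ Xe e
  if7 : ∀ e ∈ T, ∀ p ∈ Γ.cone T e, ∀ g ∉ (𝒢.α e).range, ∀ z ∈ X p,
    𝒢.vert T (Γ.o e) g • z ∈ Xe e
  if8 : ∀ e ∈ T, ∀ s ∉ T, Γ.o s ∈ Γ.cone T e → ∀ g ∉ (𝒢.α e).range, ∀ z ∈ Z s,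
    𝒢.vert T (Γ.o e) g • z ∈ Xe e

/-- The point `z` belongs to one of the images contained in `X_p` by the conditions `if4`, `if7`
and `if8`. -/
def IsImagePoint (X : V → Set Ω) (Z : ε × Bool → Set Ω) (p : V) (z : Ω) : Prop :=
  (∃ s ∉ T, Γ.o s = p ∧ ∃ g ∉ (𝒢.α s).range, ∃ y ∈ Z s, 𝒢.vert T (Γ.o s) g • y = z) ∨
  (∃ e ∈ T, Γ.o e = p ∧ ∃ q ∈ Γ.cone T e, ∃ g ∉ (𝒢.α e).range, ∃ y ∈ X q,
    𝒢.vert T (Γ.o e) g • y = z) ∨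
  (∃ e ∈ T, Γ.o e = p ∧ ∃ s ∉ T, Γ.o s ∈ Γ.cone T e ∧ ∃ g ∉ (𝒢.α e).range, ∃ y ∈ Z s,
    𝒢.vert T (Γ.o e) g • y = z)

/-- The interactive family is proper. -/
structure IsProperInteractive (X : V → Set Ω) (Z Xe : ε × Bool → Set Ω) : Prop
    extends 𝒢.IsInteractive T X Z Xe where
  if9_Z : ∀ s ∉ T, ∀ a : 𝒢.A s.1,
    (∀ z ∈ Z s, 𝒢.vert T (Γ.o s) (𝒢.α s a) • z = z) → a = 1
  if9_X : ∀ e ∈ T, (Xe e).Nonempty → ∀ a : 𝒢.A e.1,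
    (∀ z ∈ Xe e, 𝒢.vert T (Γ.o e) (𝒢.α e a) • z = z) → a = 1
  if10 : (∃ p, (X p).Nonempty) → ∃ p, ∃ z ∈ X p, ¬ 𝒢.IsImagePoint T X Z p z
  if11 : ∀ s ∉ T, (∀ s' ∉ T, s' = s ∨ s' = bar s) → (∀ p, X p = ∅) →
    ∃ z, z ∉ Z s ∪ Z (bar s) ∧ 𝒢.edge T s • z ∈ Z s ∧ 𝒢.edge T (bar s) • z ∈ Z (bar s)

end Interactive

end GraphOfGroups

/-! ### Geodesics and cones in a spanning tree. -/

namespace SerreGraph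

variable {V : Type u} {ε : Type v} {Γ : SerreGraph V ε} {T : Set (ε × Bool)}

/-! Let `g` act trivially. Ping-pong on the half-spaces `halfSpace` places `g` in a vertex group;
faithfulness on a single `Z s` or `Xe e` then kills it. If some `X p` is non-empty, take `z ∈ X p`
that is not an image point and write `g` as a good word from `p` to `p`, up to elements of the
vertex group (`hasGoodWord`). The word sends `z` beyond its first edge (`goodWord_smul`). A
remaining vertex element then either keeps the point beyond that edge, outside `X p`, or makes it an
image point; neither can be `z`, so the word is empty. If every `X p` is empty, all edge groups
equal the vertex groups, and ordinary ping-pong of reduced free words on the sets `Z s` applies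
(`mem_vertSub_of_forall_eq_empty`). Finally, an element of a vertex group fixing a point beyond an
edge lies in the edge group, hence, for a tree edge, in the next vertex group. It can so be carried
along the tree to the place where faithfulness is assumed (`eq_one_of_mem_vertSub`). -/

@[simp]
theorem bar_bar (e : ε × Bool) : bar (bar e) = e := by
  simp [bar]

theorem bar_ne (e : ε × Bool) : bar e ≠ e := by
  rcases e with ⟨e, b⟩
  cases b <;> simp [bar]

theorem t_bar (Γ : SerreGraph V ε) (e : ε × Bool) : Γ.t (bar e) = Γ.o e := by
  rw [t, bar_bar]

theorem IsPath.append_cons_left {e : ε × Bool} {l₁ l₂ : List (ε × Bool)} {p q : V}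
    (h : Γ.IsPath p q (l₁ ++ e :: l₂)) : Γ.IsPath p (Γ.o e) l₁ := by
  induction l₁ generalizing p with
  | nil => exact h.1.symm
  | cons f l ih => exact ⟨h.1, ih h.2⟩

theorem IsSpanningTree.bar_notMem (hT : Γ.IsSpanningTree T) {e : ε × Bool} (he : e ∉ T) :
    bar e ∉ T :=
  fun h => he (by simpa using hT.bar_mem _ h)

/-- The part of the geodesic before `e` is a closed reduced path in the tree, hence empty. -/
theorem IsSpanningTree.head_eq (hT : Γ.IsSpanningTree T) {e : ε × Bool} {q : V}
    {l : List (ε × Bool)} (hl : Γ.IsGeodesicIn T (Γ.o e) q l) (he : e ∈ l) :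
    ∃ l', l = e :: l' := by
  obtain ⟨l₁, l₂, rfl⟩ := List.append_of_mem he
  have : l₁ = [] := hT.acyclic _ _ ⟨hl.1.append_cons_left, (List.isChain_append.1 hl.2.1).1,
    fun f hf => hl.2.2 f (List.mem_append_left _ hf)⟩
  exact ⟨l₂, by rw [this, List.nil_append]⟩

theorem isGeodesicIn_singleton {e : ε × Bool} (he : e ∈ T) :
    Γ.IsGeodesicIn T (Γ.o e) (Γ.t e) [e] :=
  ⟨⟨rfl, rfl⟩, List.isChain_singleton _, by simpa using he⟩

theorem IsGeodesicIn.cons {e f : ε × Bool} {q : V} {l : List (ε × Bool)}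
    (hl : Γ.IsGeodesicIn T (Γ.o f) q (f :: l)) (he : e ∈ T) (hef : Γ.o f = Γ.t e)
    (hne : f ≠ bar e) : Γ.IsGeodesicIn T (Γ.o e) q (e :: f :: l) :=
  ⟨⟨rfl, hef ▸ hl.1⟩, List.isChain_cons_cons.2 ⟨hne, hl.2.1⟩,
    List.forall_mem_cons.2 ⟨he, hl.2.2⟩⟩

theorem target_mem_cone {e : ε × Bool} (he : e ∈ T) : Γ.t e ∈ Γ.cone T e :=
  ⟨[e], isGeodesicIn_singleton he, List.mem_singleton.2 rfl⟩

theorem IsSpanningTree.origin_notMem_cone (hT : Γ.IsSpanningTree T) (e : ε × Bool) :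
    Γ.o e ∉ Γ.cone T e := by
  rintro ⟨l, hl, he⟩
  rw [hT.acyclic _ l hl] at he
  exact List.not_mem_nil he

theorem IsSpanningTree.cone_subset (hT : Γ.IsSpanningTree T) {e f : ε × Bool} (he : e ∈ T)
    (hef : Γ.o f = Γ.t e) (hne : f ≠ bar e) : Γ.cone T f ⊆ Γ.cone T e := by
  rintro q ⟨l, hl, hf⟩
  obtain ⟨l', rfl⟩ := hT.head_eq hl hf
  exact ⟨_, hl.cons he hef hne, List.mem_cons_self⟩

/-- A property of vertices holding at `p` holds at `q`, if it is inherited across every edge of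
the tree pointing towards `q`. -/
theorem IsSpanningTree.induction_towards (hT : Γ.IsSpanningTree T) {q : V} {P : V → Prop}
    (step : ∀ e ∈ T, q ∈ Γ.cone T e → P (Γ.o e) → P (Γ.t e)) {p : V} (hp : P p) : P q := by
  have exists_geodesic : ∀ (l : List (ε × Bool)) (p : V), Γ.IsPath p q l → (∀ e ∈ l, e ∈ T) →
      ∃ l', Γ.IsGeodesicIn T p q l' := by
    intro l
    induction l with
    | nil => exact fun p hp _ => ⟨[], hp, List.isChain_nil, by simp⟩
    | cons e l ih =>
      rintro p ⟨rfl, hl⟩ hmem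
      obtain ⟨he, hmem⟩ := List.forall_mem_cons.1 hmem
      obtain ⟨l', hl'⟩ := ih _ hl hmem
      rcases l' with _ | ⟨f, l'⟩
      · exact ⟨[e], ⟨rfl, hl'.1⟩, List.isChain_singleton _, by simpa using he⟩
      -- A backtracking pair `e`, `bar e` is deleted; otherwise `e` is prepended.
      · by_cases hf : f = bar e
        · subst hf
          exact ⟨l', by simpa [t_bar] using hl'.1.2, hl'.2.1.tail,
            fun x hx => hl'.2.2 x (List.mem_cons_of_mem _ hx)⟩
        · have hof : Γ.o f = Γ.t e := hl'.1.1
          exact ⟨_, (hof ▸ hl').cons he hof hf⟩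
  obtain ⟨l₀, hl₀, hmem₀⟩ := hT.connected p q
  obtain ⟨l, hl⟩ := exists_geodesic l₀ p hl₀ hmem₀
  clear hl₀ hmem₀ l₀
  induction l generalizing p with
  | nil => exact (show p = q from hl.1) ▸ hp
  | cons e l ih =>
    obtain ⟨⟨rfl, hpath⟩, hchain, hmem⟩ := hl
    obtain ⟨he, hmem'⟩ := List.forall_mem_cons.1 hmem
    exact ih (step e he ⟨e :: l, ⟨⟨rfl, hpath⟩, hchain, hmem⟩, List.mem_cons_self⟩ hp)
      ⟨hpath, hchain.tail, hmem'⟩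

end SerreGraph

/-! ### Vertex and edge subgroups of the fundamental group. -/

namespace GraphOfGroups

open SerreGraph

variable {V : Type u} {ε : Type v} {Γ : SerreGraph V ε}
  (𝒢 : GraphOfGroups.{u, v, w, x} Γ) (T : Set (ε × Bool))

theorem edge_bar (e : ε × Bool) : 𝒢.edge T (bar e) = (𝒢.edge T e)⁻¹ := by
  have key : PresentedGroup.mk {r | 𝒢.Rel T r} (𝒢.genE (bar e) * 𝒢.genE e) = 1 :=
    PresentedGroup.one_of_mem (Rel.inverse e)
  rw [map_mul] at key
  exact eq_inv_of_mul_eq_one_left key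

theorem edge_of_mem {e : ε × Bool} (he : e ∈ T) : 𝒢.edge T e = 1 :=
  PresentedGroup.one_of_mem (rels := {r | 𝒢.Rel T r}) (Rel.tree e he)

theorem edge_conj (e : ε × Bool) (a : 𝒢.A e.1) :
    (𝒢.edge T e)⁻¹ * 𝒢.vert T (Γ.o e) (𝒢.α e a) * 𝒢.edge T e =
      𝒢.vert T (Γ.t e) (𝒢.ω e a) := by
  have key : PresentedGroup.mk {r | 𝒢.Rel T r} ((𝒢.genE e)⁻¹ * 𝒢.genV (Γ.o e) (𝒢.α e a) *
      𝒢.genE e * (𝒢.genV (Γ.t e) (𝒢.ω e a))⁻¹) = 1 :=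
    PresentedGroup.one_of_mem (Rel.edge e a)
  rw [map_mul, map_inv, mul_inv_eq_one, map_mul, map_mul, map_inv] at key
  exact key

/-- A property of elements of the fundamental group is universal if it holds at `1` and is
preserved under left multiplication by the generators. -/
theorem pi1_induction {P : 𝒢.Pi1 T → Prop} (one : P 1)
    (vert_mul : ∀ p h g, P g → P (𝒢.vert T p h * g))
    (edge_mul : ∀ e g, P g → P (𝒢.edge T e * g)) (g : 𝒢.Pi1 T) : P g := by
  have hg : g ∈ Subgroup.closure
      (Set.range (PresentedGroup.of (rels := {r | 𝒢.Rel T r}))) := by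
    rw [PresentedGroup.closure_range_of]
    trivial
  induction hg using Subgroup.closure_induction_left with
  | one => exact one
  | mul_left y hy g _ ih =>
    obtain ⟨⟨p, h⟩ | e, rfl⟩ := hy
    · exact vert_mul p h g ih
    · exact edge_mul e g ih
  | inv_mul_cancel y hy g _ ih =>
    obtain ⟨⟨p, h⟩ | e, rfl⟩ := hy
    · have := vert_mul p h⁻¹ g ih
      rwa [map_inv] at this
    · have := edge_mul (bar e) g ih
      rwa [edge_bar] at this

/-- The image of a vertex group in the fundamental group. -/
def vertSub (p : V) : Subgroup (𝒢.Pi1 T) := (𝒢.vert T p).range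

/-- The image of an edge group in the fundamental group. -/
def edgeSub (e : ε × Bool) : Subgroup (𝒢.Pi1 T) := (𝒢.α e).range.map (𝒢.vert T (Γ.o e))

variable {𝒢 T}

theorem edgeSub_le (e : ε × Bool) : 𝒢.edgeSub T e ≤ 𝒢.vertSub T (Γ.o e) := by
  rintro _ ⟨g, _, rfl⟩
  exact ⟨g, rfl⟩

theorem mem_edgeSub {e : ε × Bool} {g : 𝒢.Pi1 T} :
    g ∈ 𝒢.edgeSub T e ↔ ∃ a, 𝒢.vert T (Γ.o e) (𝒢.α e a) = g := by
  simp [edgeSub]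

theorem exists_of_notMem_edgeSub {e : ε × Bool} {g : 𝒢.Pi1 T} (hg : g ∈ 𝒢.vertSub T (Γ.o e))
    (hg' : g ∉ 𝒢.edgeSub T e) : ∃ h ∉ (𝒢.α e).range, 𝒢.vert T (Γ.o e) h = g := by
  obtain ⟨h, rfl⟩ := hg
  exact ⟨h, fun hh => hg' ⟨h, hh, rfl⟩, rfl⟩

theorem edge_inv_mul_mul_mem {e : ε × Bool} {g : 𝒢.Pi1 T} (hg : g ∈ 𝒢.edgeSub T e) :
    (𝒢.edge T e)⁻¹ * g * 𝒢.edge T e ∈ 𝒢.edgeSub T (bar e) := by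
  obtain ⟨a, rfl⟩ := mem_edgeSub.1 hg
  exact mem_edgeSub.2 ⟨a, (𝒢.edge_conj T e a).symm⟩

theorem edge_mul_mul_inv_mem {e : ε × Bool} {g : 𝒢.Pi1 T} (hg : g ∈ 𝒢.edgeSub T (bar e)) :
    𝒢.edge T e * g * (𝒢.edge T e)⁻¹ ∈ 𝒢.edgeSub T e := by
  simpa [edge_bar] using edge_inv_mul_mul_mem hg

theorem edgeSub_le_target {e : ε × Bool} (he : e ∈ T) :
    𝒢.edgeSub T e ≤ 𝒢.vertSub T (Γ.t e) := by
  intro g hg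
  have := edge_inv_mul_mul_mem hg
  rw [edge_of_mem 𝒢 T he, inv_one, one_mul, mul_one] at this
  exact edgeSub_le _ this

/-! ### Normal forms for elements of the fundamental group. -/

section Words

variable (𝒢 T) in
/-- `𝒢.GoodWord T p e g`: the element `g` is a product `e₁ g₁ e₂ ⋯ gₙ₋₁ eₙ` along an edge path
ending at `p` with `e₁ = e`, which is reduced, and where every `gᵢ` preceding an edge of the
tree is either trivial or outside of the edge group. -/
inductive GoodWord (p : V) : ε × Bool → 𝒢.Pi1 T → Prop
  | single (e : ε × Bool) (he : Γ.t e = p) : GoodWord p e (𝒢.edge T e)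
  | cons (e f : ε × Bool) (hef : Γ.o f = Γ.t e) (k g : 𝒢.Pi1 T) (hk : k ∈ 𝒢.vertSub T (Γ.o f))
      (hred : k ∉ 𝒢.edgeSub T f ∨ f ≠ bar e ∧ (k = 1 ∨ f ∉ T)) (hg : GoodWord p f g) :
      GoodWord p e (𝒢.edge T e * k * g)

/-- An element of the edge group to the left of a good word can be pushed to the right, where it
is absorbed unless the word is a geodesic of the tree or begins outside of the tree. -/
theorem GoodWord.push {p : V} {e : ε × Bool} {g : 𝒢.Pi1 T} (hg : 𝒢.GoodWord T p e g) :
    ∀ a ∈ 𝒢.edgeSub T e, ∃ g' h, 𝒢.GoodWord T p e g' ∧ h ∈ 𝒢.vertSub T p ∧ a * g = g' * h ∧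
      (h = 1 ∨ e ∉ T ∨ ∃ l, Γ.IsGeodesicIn T (Γ.o e) p (e :: l)) := by
  induction hg with
  | single e he =>
    intro a ha
    subst he
    refine ⟨_, _, .single e rfl, edgeSub_le _ (edge_inv_mul_mul_mem ha), by group, .inr ?_⟩
    by_cases he : e ∈ T
    · exact .inr ⟨[], isGeodesicIn_singleton he⟩
    · exact .inl he
  | cons e f hef k g hk hred hg ih =>
    intro a ha
    have hb := edge_inv_mul_mul_mem ha
    have eq : a * (𝒢.edge T e * k * g) =
        𝒢.edge T e * ((𝒢.edge T e)⁻¹ * a * 𝒢.edge T e * k) * g := by group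
    rw [eq]
    generalize (𝒢.edge T e)⁻¹ * a * 𝒢.edge T e = b at hb
    have hbk : b * k ∈ 𝒢.vertSub T (Γ.o f) := mul_mem (hef ▸ edgeSub_le _ hb) hk
    -- After `b` has crossed `e`, only a product `b * k` in the edge group of a tree edge `f`
    -- violates the word condition; it is replaced by `1` and pushed further.
    by_cases hmem : b * k ∈ 𝒢.edgeSub T f
    · have hne : f ≠ bar e := by
        rcases hred with hk' | h
        · rintro rfl
          exact hk' ((Subgroup.mul_mem_cancel_left _ hb).1 hmem)
        · exact h.1
      by_cases hf : f ∈ T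
      · obtain ⟨g', h, hg', hh, eq', hor⟩ := ih _ hmem
        refine ⟨𝒢.edge T e * 1 * g', h,
          .cons e f hef 1 g' (one_mem _) (.inr ⟨hne, .inl rfl⟩) hg', hh, ?_, ?_⟩
        · rw [mul_assoc, eq', mul_one, mul_assoc]
        · rcases hor with h1 | hf' | ⟨l, hl⟩
          · exact .inl h1
          · exact absurd hf hf'
          · by_cases he : e ∈ T
            · exact .inr (.inr ⟨_, hl.cons he hef hne⟩)
            · exact .inr (.inl he)
      · exact ⟨_, 1, .cons e f hef _ g hbk (.inr ⟨hne, .inr hf⟩) hg, one_mem _,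
          (mul_one _).symm, .inl rfl⟩
    · exact ⟨_, 1, .cons e f hef _ g hbk (.inl hmem) hg, one_mem _, (mul_one _).symm, .inl rfl⟩

variable (𝒢 T) in
/-- `g` can be written as a good word from `q` to `p`, up to elements of the groups at `q` and
at `p`. -/
def HasGoodWord (p q : V) (g : 𝒢.Pi1 T) : Prop :=
  (q = p ∧ g ∈ 𝒢.vertSub T p) ∨ ∃ e g', Γ.o e = q ∧ 𝒢.GoodWord T p e g' ∧
    ∃ k ∈ 𝒢.vertSub T q, ∃ h ∈ 𝒢.vertSub T p, g = k * g' * h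

theorem HasGoodWord.mul_left {p q : V} {g k : 𝒢.Pi1 T} (hg : 𝒢.HasGoodWord T p q g)
    (hk : k ∈ 𝒢.vertSub T q) : 𝒢.HasGoodWord T p q (k * g) := by
  rcases hg with ⟨rfl, hg⟩ | ⟨e, g', he, hg', k', hk', h, hh, rfl⟩
  · exact .inl ⟨rfl, mul_mem hk hg⟩
  · exact .inr ⟨e, g', he, hg', _, mul_mem hk hk', h, hh, by group⟩

/-- A new letter `e` either cancels against a first letter `bar e`, or is prepended; in the latter
case an edge group element between the two is first pushed to the right end by `GoodWord.push`. -/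
theorem HasGoodWord.edge_mul {p : V} {e : ε × Bool} {g : 𝒢.Pi1 T}
    (hg : 𝒢.HasGoodWord T p (Γ.t e) g) : 𝒢.HasGoodWord T p (Γ.o e) (𝒢.edge T e * g) := by
  rcases hg with ⟨he, hg⟩ | ⟨f, g', hf, hg', k, hk, h, hh, rfl⟩
  · exact .inr ⟨e, _, rfl, .single e he, 1, one_mem _, g, hg, by group⟩
  by_cases hkf : k ∈ 𝒢.edgeSub T f
  · by_cases hne : f = bar e
    · subst hne
      have hk' := edgeSub_le _ (edge_mul_mul_inv_mem hkf)
      cases hg' with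
      | single _ hp =>
        rw [t_bar] at hp
        subst hp
        refine .inl ⟨rfl, ?_⟩
        have := mul_mem hk' hh
        rwa [mul_assoc (𝒢.edge T e), ← edge_bar, mul_assoc] at this
      | cons _ f' hf' k' g' hk'' _ hg' =>
        rw [t_bar] at hf'
        refine .inr ⟨f', g', hf', hg', _, mul_mem hk' (hf' ▸ hk''), h, hh, ?_⟩
        rw [edge_bar]
        group
    · obtain ⟨g'', h', hg'', hh', eq, -⟩ := hg'.push k hkf
      refine .inr ⟨e, _, rfl, .cons e f hf 1 g'' (one_mem _) (.inr ⟨hne, .inl rfl⟩) hg'', 1,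
        one_mem _, _, mul_mem hh' hh, ?_⟩
      rw [eq]
      group
  · exact .inr ⟨e, _, rfl, .cons e f hf k g' (hf ▸ hk) (.inl hkf) hg', 1, one_mem _, h, hh,
      by group⟩

/-- Tree edges are trivial in the group, so multiplying by them moves the starting vertex without
changing `g`. -/
theorem HasGoodWord.of_isSpanningTree (hT : Γ.IsSpanningTree T) {p q : V} {g : 𝒢.Pi1 T}
    (hg : 𝒢.HasGoodWord T p q g) (q' : V) : 𝒢.HasGoodWord T p q' g := by
  refine hT.induction_towards (P := fun q => 𝒢.HasGoodWord T p q g) (fun e he _ h => ?_) hg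
  have := HasGoodWord.edge_mul (e := bar e) (by rwa [t_bar])
  rwa [edge_of_mem 𝒢 T (hT.bar_mem e he), one_mul] at this

theorem hasGoodWord (hT : Γ.IsSpanningTree T) (p q : V) (g : 𝒢.Pi1 T) :
    𝒢.HasGoodWord T p q g := by
  refine 𝒢.pi1_induction T (P := fun g => ∀ q, 𝒢.HasGoodWord T p q g) ?_ ?_ ?_ g q
  · exact HasGoodWord.of_isSpanningTree hT (.inl ⟨rfl, one_mem _⟩)
  · exact fun r h g hg => ((hg r).mul_left ⟨h, rfl⟩).of_isSpanningTree hT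
  · exact fun e g hg => (hg _).edge_mul.of_isSpanningTree hT

/-! ### The degenerate case in which every edge group is the whole vertex group. -/

variable (𝒢 T) in
/-- `g` is a reduced word in the edges outside of the tree, with first letter `s` and last
letter `s'`. -/
inductive FreeWord : ε × Bool → ε × Bool → 𝒢.Pi1 T → Prop
  | single (s : ε × Bool) (hs : s ∉ T) : FreeWord s s (𝒢.edge T s)
  | cons (s r s' : ε × Bool) (g : 𝒢.Pi1 T) (hs : s ∉ T) (hr : r ≠ bar s)
      (hg : FreeWord r s' g) : FreeWord s s' (𝒢.edge T s * g)

theorem FreeWord.head_notMem {s s' : ε × Bool} {g : 𝒢.Pi1 T} (hg : 𝒢.FreeWord T s s' g) :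
    s ∉ T := by
  cases hg <;> assumption

theorem FreeWord.last_notMem {s s' : ε × Bool} {g : 𝒢.Pi1 T} (hg : 𝒢.FreeWord T s s' g) :
    s' ∉ T := by
  induction hg <;> assumption

theorem edgeSub_eq_vertSub (h : ∀ e, (𝒢.α e).range = ⊤) (e : ε × Bool) :
    𝒢.edgeSub T e = 𝒢.vertSub T (Γ.o e) := by
  rw [edgeSub, h, vertSub, MonoidHom.range_eq_map]

theorem vertSub_le_vertSub (hT : Γ.IsSpanningTree T) (h : ∀ e, (𝒢.α e).range = ⊤) (p q : V) :
    𝒢.vertSub T p ≤ 𝒢.vertSub T q := by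
  intro g hg
  refine hT.induction_towards (P := fun q => g ∈ 𝒢.vertSub T q) (fun e he _ hg => ?_) hg
  rw [← edgeSub_eq_vertSub h] at hg
  exact edgeSub_le_target he hg

/-- If all edge groups coincide with the vertex groups, then the fundamental group is generated
by a normal subgroup and a free group. -/
theorem mem_vertSub_or_exists_freeWord (hT : Γ.IsSpanningTree T)
    (hα : ∀ e, (𝒢.α e).range = ⊤) (p : V) (g : 𝒢.Pi1 T) :
    g ∈ 𝒢.vertSub T p ∨
      ∃ k ∈ 𝒢.vertSub T p, ∃ s s' g', 𝒢.FreeWord T s s' g' ∧ g = k * g' := by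
  have hH := vertSub_le_vertSub (𝒢 := 𝒢) hT hα
  -- All vertex groups have the same image, which every edge therefore normalizes.
  have conj (e : ε × Bool) {k : 𝒢.Pi1 T} (hk : k ∈ 𝒢.vertSub T p) :
      𝒢.edge T e * k * (𝒢.edge T e)⁻¹ ∈ 𝒢.vertSub T p := by
    refine hH (Γ.o e) _ (edgeSub_le e (edge_mul_mul_inv_mem ?_))
    rw [edgeSub_eq_vertSub hα]
    exact hH _ _ hk
  induction g using 𝒢.pi1_induction T with
  | one => exact .inl (one_mem _)
  | vert_mul q h g ih =>
    have hq : 𝒢.vert T q h ∈ 𝒢.vertSub T p := hH q p ⟨h, rfl⟩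
    rcases ih with hg | ⟨k, hk, s, s', g', hg', rfl⟩
    · exact .inl (mul_mem hq hg)
    · exact .inr ⟨_, mul_mem hq hk, s, s', g', hg', (mul_assoc _ _ _).symm⟩
  | edge_mul e g ih =>
    by_cases he : e ∈ T
    · rwa [edge_of_mem 𝒢 T he, one_mul]
    rcases ih with hg | ⟨k, hk, s, s', g', hg', rfl⟩
    · exact .inr ⟨_, conj e hg, e, e, _, .single e he, by group⟩
    have eq : 𝒢.edge T e * (k * g') =
        𝒢.edge T e * k * (𝒢.edge T e)⁻¹ * (𝒢.edge T e * g') := by group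
    rw [eq]
    by_cases hs : s = bar e
    · subst hs
      cases hg' with
      | single =>
        rw [edge_bar, mul_inv_cancel, mul_one]
        exact .inl (conj e hk)
      | cons _ r _ g' _ _ hg' =>
        rw [edge_bar, mul_inv_cancel_left]
        exact .inr ⟨_, conj e hk, r, s', g', hg', rfl⟩
    · exact .inr ⟨_, conj e hk, e, s', _, .cons e s s' g' he hs hg', rfl⟩

end Words

/-! ### Ping-pong on half-spaces. -/

section Action

variable {Ω : Type y} [MulAction (𝒢.Pi1 T) Ω] {X : V → Set Ω} {Z Xe : ε × Bool → Set Ω}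

variable (Γ T) in
/-- The part of `Ω` lying beyond the oriented edge `e`. -/
def halfSpace {Ω : Type y} (X : V → Set Ω) (Z : ε × Bool → Set Ω) (e : ε × Bool) : Set Ω :=
  {z | (e ∉ T ∧ z ∈ Z e) ∨ (e ∈ T ∧ ((∃ p ∈ Γ.cone T e, z ∈ X p) ∨
    ∃ s ∉ T, Γ.o s ∈ Γ.cone T e ∧ z ∈ Z s))}

namespace IsInteractive

theorem disjoint_halfSpace (hF : 𝒢.IsInteractive T X Z Xe) (hT : Γ.IsSpanningTree T)
    (e : ε × Bool) : Disjoint (X (Γ.o e)) (halfSpace Γ T X Z e) := by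
  rw [Set.disjoint_left]
  rintro z hz (⟨he, hz'⟩ | ⟨he, ⟨p, hp, hz'⟩ | ⟨s, hs, hp, hz'⟩⟩)
  · exact (hF.if1_XZ _ e he).le_bot ⟨hz, hz'⟩
  · refine (hF.if1_XX (Γ.o e) p ?_).le_bot ⟨hz, hz'⟩
    rintro rfl
    exact hT.origin_notMem_cone e hp
  · exact (hF.if1_XZ _ s hs).le_bot ⟨hz, hz'⟩

theorem edge_smul_vertex (hF : 𝒢.IsInteractive T X Z Xe) (e : ε × Bool) {z : Ω}
    (hz : z ∈ X (Γ.t e)) : 𝒢.edge T e • z ∈ halfSpace Γ T X Z e := by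
  by_cases he : e ∈ T
  · rw [edge_of_mem 𝒢 T he, one_smul]
    exact .inr ⟨he, .inl ⟨_, target_mem_cone he, hz⟩⟩
  · exact .inl ⟨he, hF.if2_X e he _ z hz⟩

theorem edge_smul_halfSpace (hF : 𝒢.IsInteractive T X Z Xe) (hT : Γ.IsSpanningTree T)
    {e f : ε × Bool} (hef : Γ.o f = Γ.t e) (hne : f ≠ bar e) {z : Ω}
    (hz : z ∈ halfSpace Γ T X Z f) : 𝒢.edge T e • z ∈ halfSpace Γ T X Z e := by
  by_cases he : e ∈ T
  · rw [edge_of_mem 𝒢 T he, one_smul]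
    refine .inr ⟨he, ?_⟩
    rcases hz with ⟨hf, hz⟩ | ⟨hf, ⟨p, hp, hz⟩ | ⟨s, hs, hp, hz⟩⟩
    · exact .inr ⟨f, hf, hef ▸ target_mem_cone he, hz⟩
    · exact .inl ⟨p, hT.cone_subset he hef hne hp, hz⟩
    · exact .inr ⟨s, hs, hT.cone_subset he hef hne hp, hz⟩
  · refine .inl ⟨he, ?_⟩
    rcases hz with ⟨hf, hz⟩ | ⟨hf, ⟨p, hp, hz⟩ | ⟨s, hs, hp, hz⟩⟩
    · exact hF.if2_Z e he f hf hne z hz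
    · exact hF.if2_X e he p z hz
    · refine hF.if2_Z e he s hs ?_ z hz
      rintro rfl
      -- If `s` were `bar e`, its origin would be that of `f`, which is not in the cone of `f`.
      refine hT.origin_notMem_cone f ?_
      rwa [hef]

theorem smul_halfSpace (hF : 𝒢.IsInteractive T X Z Xe) {e : ε × Bool} {g : 𝒢.Pi1 T}
    (hg : g ∈ 𝒢.vertSub T (Γ.o e)) (hg' : g ∉ 𝒢.edgeSub T e) {z : Ω}
    (hz : z ∈ halfSpace Γ T X Z e) :
    g • z ∈ X (Γ.o e) ∧ 𝒢.IsImagePoint T X Z (Γ.o e) (g • z) := by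
  obtain ⟨h, hh, rfl⟩ := exists_of_notMem_edgeSub hg hg'
  rcases hz with ⟨he, hz⟩ | ⟨he, ⟨p, hp, hz⟩ | ⟨s, hs, hp, hz⟩⟩
  · exact ⟨hF.if4 e he h hh z hz, .inl ⟨e, he, rfl, h, hh, z, hz, rfl⟩⟩
  · exact ⟨hF.if5_subset e he (hF.if7 e he p hp h hh z hz),
      .inr (.inl ⟨e, he, rfl, p, hp, h, hh, z, hz, rfl⟩)⟩
  · exact ⟨hF.if5_subset e he (hF.if8 e he s hs hp h hh z hz),
      .inr (.inr ⟨e, he, rfl, s, hs, hp, h, hh, z, hz, rfl⟩)⟩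

theorem edgeSub_smul (hF : 𝒢.IsInteractive T X Z Xe) {s : ε × Bool} (hs : s ∉ T)
    {g : 𝒢.Pi1 T} (hg : g ∈ 𝒢.edgeSub T s) {z : Ω} (hz : z ∈ Z s) : g • z ∈ Z s := by
  obtain ⟨a, rfl⟩ := mem_edgeSub.1 hg
  exact hF.if3 s hs a z hz

theorem goodWord_smul (hF : 𝒢.IsInteractive T X Z Xe) (hT : Γ.IsSpanningTree T) {p : V}
    {e : ε × Bool} {g : 𝒢.Pi1 T} (hg : 𝒢.GoodWord T p e g) {z : Ω} (hz : z ∈ X p) :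
    g • z ∈ halfSpace Γ T X Z e := by
  induction hg with
  | single e he => exact hF.edge_smul_vertex e (he ▸ hz)
  | cons e f hef k g hk hred _ ih =>
    rw [mul_smul, mul_smul]
    by_cases hkf : k ∈ 𝒢.edgeSub T f
    · obtain ⟨hne, rfl | hf⟩ := hred.resolve_left (not_not_intro hkf)
      · rw [one_smul]
        exact hF.edge_smul_halfSpace hT hef hne ih
      -- Off the tree the half-space is `Z f`, stable under the edge group by `if3`. No such
      -- stability is assumed for tree edges, which is why `GoodWord` demands `k = 1` there.
      · refine hF.edge_smul_halfSpace hT hef hne (.inl ⟨hf, hF.edgeSub_smul hf hkf ?_⟩)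
        exact (ih.resolve_right fun h => hf h.1).2
    · exact hF.edge_smul_vertex e (hef ▸ (hF.smul_halfSpace hk hkf ih).1)

theorem freeWord_smul (hF : 𝒢.IsInteractive T X Z Xe) {s s' : ε × Bool} {g : 𝒢.Pi1 T}
    (hg : 𝒢.FreeWord T s s' g) {z : Ω} (hz : 𝒢.edge T s' • z ∈ Z s') : g • z ∈ Z s := by
  induction hg with
  | single s _ => exact hz
  | cons s r s' g hs hr hg ih =>
    rw [mul_smul]
    exact hF.if2_Z s hs r hg.head_notMem hr _ (ih hz)

/-- An element of a vertex group fixing a point beyond an edge belongs to the edge group. -/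
theorem mem_edgeSub_of_smul_eq (hF : 𝒢.IsInteractive T X Z Xe) (hT : Γ.IsSpanningTree T)
    {e : ε × Bool} {g : 𝒢.Pi1 T} (hg : g ∈ 𝒢.vertSub T (Γ.o e)) {z : Ω}
    (hz : z ∈ halfSpace Γ T X Z e) (hgz : g • z = z) : g ∈ 𝒢.edgeSub T e := by
  by_contra hg'
  have := (hF.smul_halfSpace hg hg' hz).1
  rw [hgz] at this
  exact (hF.disjoint_halfSpace hT e).le_bot ⟨this, hz⟩

end IsInteractive

/-! ### Elements acting trivially. -/

namespace IsProperInteractive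

/-- An element of a vertex group acting trivially is trivial. -/
theorem eq_one_of_mem_vertSub (hF : 𝒢.IsProperInteractive T X Z Xe) (hT : Γ.IsSpanningTree T)
    (hne : (∃ s, s ∉ T) ∨
      ∃ e ∈ T, ∃ p ∈ Γ.cone T e, (Xe e).Nonempty ∧ (X p).Nonempty)
    {p : V} {g : 𝒢.Pi1 T} (hg : g ∈ 𝒢.vertSub T p) (hfix : ∀ z : Ω, g • z = z) : g = 1 := by
  have hI := hF.toIsInteractive
  -- Each tree edge on the way to `q` has a point beyond it, and `g` fixes that point.
  have transport (q : V) (hq : ∀ e ∈ T, q ∈ Γ.cone T e → (halfSpace Γ T X Z e).Nonempty) :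
      g ∈ 𝒢.vertSub T q := by
    refine hT.induction_towards (P := fun q => g ∈ 𝒢.vertSub T q) (fun e he hc hg => ?_) hg
    obtain ⟨z, hz⟩ := hq e he hc
    exact edgeSub_le_target he (hI.mem_edgeSub_of_smul_eq hT hg hz (hfix z))
  rcases hne with ⟨s, hs⟩ | ⟨e, he, q, hq, ⟨x, hx⟩, z, hz⟩
  · obtain ⟨z, hz⟩ := hF.if1_Z_nonempty s hs
    have hg := transport (Γ.o s) fun e he hc => ⟨z, .inr ⟨he, .inr ⟨s, hs, hc, hz⟩⟩⟩
    obtain ⟨a, rfl⟩ :=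
      mem_edgeSub.1 (hI.mem_edgeSub_of_smul_eq hT hg (.inl ⟨hs, hz⟩) (hfix z))
    rw [hF.if9_Z s hs a fun z _ => hfix z, map_one, map_one]
  · have hg := transport (Γ.o e) fun f hf hc =>
      ⟨x, .inr ⟨hf, .inl ⟨_, hc, hF.if5_subset e he hx⟩⟩⟩
    obtain ⟨a, rfl⟩ := mem_edgeSub.1
      (hI.mem_edgeSub_of_smul_eq hT hg (.inr ⟨he, .inl ⟨q, hq, hz⟩⟩) (hfix z))
    rw [hF.if9_X e he ⟨x, hx⟩ a fun z _ => hfix z, map_one, map_one]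

/-- If a vertex set contains a point which is not an image point, then elements acting trivially
belong to the vertex group. -/
theorem mem_vertSub_of_notIsImagePoint (hF : 𝒢.IsProperInteractive T X Z Xe)
    (hT : Γ.IsSpanningTree T) {p : V} {z : Ω} (hz : z ∈ X p)
    (hz' : ¬ 𝒢.IsImagePoint T X Z p z) {g : 𝒢.Pi1 T} (hfix : ∀ z : Ω, g • z = z) :
    g ∈ 𝒢.vertSub T p := by
  have hI := hF.toIsInteractive
  rcases hasGoodWord hT p p g with ⟨-, hg⟩ | ⟨e, g', rfl, hg', k, hk, h, hh, rfl⟩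
  · exact hg
  exfalso
  -- Conjugation by `h` gathers both vertex factors on the left of the good word.
  have hfix' : (h * k * g') • z = z := by
    have := congrArg (h • ·) (hfix (h⁻¹ • z))
    simpa [smul_smul, mul_assoc] using this
  have hhk := mul_mem hh hk
  have hg'z := hI.goodWord_smul hT hg' hz
  by_cases hmem : h * k ∈ 𝒢.edgeSub T e
  · have key : (h * k * g') • z ∈ halfSpace Γ T X Z e := by
      by_cases he : e ∈ T
      · obtain ⟨g'', h', hg'', -, eq, rfl | he' | ⟨l, hl⟩⟩ := hg'.push _ hmem
        · rw [eq, mul_one]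
          exact hI.goodWord_smul hT hg'' hz
        · exact absurd he he'
        -- The word is closed, so it cannot follow a non-empty geodesic of the tree; hence the
        -- pushed factor is trivial.
        · exact absurd (hT.acyclic _ _ hl) (List.cons_ne_nil _ _)
      · rw [mul_smul]
        exact .inl ⟨he, hI.edgeSub_smul he hmem (hg'z.resolve_right fun h => he h.1).2⟩
    rw [hfix'] at key
    exact (hI.disjoint_halfSpace hT e).le_bot ⟨hz, key⟩
  · have := (hI.smul_halfSpace hhk hmem hg'z).2
    rw [← mul_smul, hfix'] at this
    exact hz' this

/-- If all vertex sets are empty, then elements acting trivially belong to the vertex group. -/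
theorem mem_vertSub_of_forall_eq_empty (hF : 𝒢.IsProperInteractive T X Z Xe)
    (hT : Γ.IsSpanningTree T) (hX : ∀ p, X p = ∅) (p : V) {g : 𝒢.Pi1 T}
    (hfix : ∀ z : Ω, g • z = z) : g ∈ 𝒢.vertSub T p := by
  have hI := hF.toIsInteractive
  have hα (e : ε × Bool) : (𝒢.α e).range = ⊤ := by
    by_contra h
    exact (hF.if1_X_nonempty e h).ne_empty (hX _)
  rcases mem_vertSub_or_exists_freeWord hT hα p g with hg | ⟨k, hk, s, s', g', hg', rfl⟩
  · exact hg
  exfalso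
  have hs := hg'.head_notMem
  have hs' := hg'.last_notMem
  have main : ∀ z ∉ Z s, 𝒢.edge T s' • z ∉ Z s' := by
    intro z hz hz'
    apply hz
    rw [← hfix z, mul_smul]
    refine hI.edgeSub_smul hs ?_ (hI.freeWord_smul hg' hz')
    rw [edgeSub_eq_vertSub hα]
    exact vertSub_le_vertSub hT hα _ _ hk
  -- For any other `r`, points of `Z r` lie outside `Z s` while `if2_Z` sends them into `Z s'`,
  -- against `main`. Applied to `bar s`, this gives `s = s'`, so only `s` and `bar s` are off the
  -- tree and `if11` supplies the point contradicting `main`.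
  have all (r : ε × Bool) (hr : r ∉ T) : r = s ∨ r = bar s' := by
    by_contra! h
    obtain ⟨z, hz⟩ := hF.if1_Z_nonempty r hr
    exact main z (fun hz' => (hF.if1_ZZ r hr s hs h.1).le_bot ⟨hz, hz'⟩)
      (hF.if2_Z s' hs' r hr h.2 z hz)
  have hss : bar s = bar s' := (all _ (hT.bar_notMem hs)).resolve_left (bar_ne s)
  obtain rfl : s = s' := by simpa using congrArg bar hss
  obtain ⟨z, hz, hz', -⟩ := hF.if11 s hs all hX
  exact main z (fun h => hz (.inl h)) hz'

end IsProperInteractive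

end Action

end GraphOfGroups

theorem mainTheorem3 {V : Type u} {ε : Type v} (Γ : SerreGraph V ε)
    (𝒢 : GraphOfGroups.{u, v, w, x} Γ)
    (T : Set (ε × Bool)) (hT : Γ.IsSpanningTree T)
    {Ω : Type y} [MulAction (𝒢.Pi1 T) Ω]
    (X : V → Set Ω) (Z Xe : ε × Bool → Set Ω)
    (hF : 𝒢.IsProperInteractive T X Z Xe)
    (hne : (∃ s, s ∉ T) ∨
      ∃ e ∈ T, ∃ p ∈ Γ.cone T e, (Xe e).Nonempty ∧ (X p).Nonempty) :
    FaithfulSMul (𝒢.Pi1 T) Ω := by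
  refine ⟨fun {g₁ g₂} h => ?_⟩
  have hfix (z : Ω) : (g₂⁻¹ * g₁) • z = z := by rw [mul_smul, h, inv_smul_smul]
  obtain ⟨p, hp⟩ : ∃ p, g₂⁻¹ * g₁ ∈ 𝒢.vertSub T p := by
    by_cases hX : ∃ p, (X p).Nonempty
    · obtain ⟨p, z, hz, hz'⟩ := hF.if10 hX
      exact ⟨p, hF.mem_vertSub_of_notIsImagePoint hT hz hz' hfix⟩
    · have hX' (p : V) : X p = ∅ := Set.not_nonempty_iff_eq_empty.1 fun h => hX ⟨p, h⟩
      rcases hne with ⟨s, -⟩ | ⟨_, _, p, _, _, hp⟩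
      · exact ⟨Γ.o s, hF.mem_vertSub_of_forall_eq_empty hT hX' _ hfix⟩
      · exact absurd ⟨p, hp⟩ hX
  exact (inv_mul_eq_one.1 (hF.eq_one_of_mem_vertSub hT hne hp hfix)).symm
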